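/- Let $\mathbb K$ be $\mathbb R$ or $\mathbb C$, and let $k,\ell,d$ be non-negative integers with $0\le \ell\le dk-1$. Let $G=(V,E)$ be a finite $d$-uniform hypergraph, i.e. $E$ is a finite multiset of $d$-element subsets of the finite set $V$, with $n=|V|$ vertices and $m=|E|=kn-\ell$ hyperedges. Assume that $G$ is $(k,\ell)$-sparse: every set of $n'$ vertices that induces $m'\ge 1$ hyperedges (a hyperedge being induced if all its endpoints lie in the set) satisfies $m'\le kn'-\ell$. For a matrix $\mathbf U$ of size $kn\times \ell$ over a field $F$, with $k$ rows for each vertex, consider the $m\times kn$ matrices $\mathbf M$ over $F$, with one row for each hyperedge and $k$ columns for each vertex, in which the row of a hyperedge $e$ vanishes outside the columns of the endpoints of $e$, and which satisfy $\mathbf M\mathbf U=0$. They form an $F$-vector space $S_G(\mathbf U)$. For a basis $\mathbf B_1,\dots,\mathbf B_r$ of it, let $\mathbf M_{k,\ell,d}(G;\mathbf U)=\sum_{i=1}^r t_i\mathbf B_i$ be the formal general solution, a matrix over $F[t_1,\dots,t_r]$ with generic variables $t_1,\dots,t_r$. The generic rank of a matrix of polynomials is the largest $s$ for which some $s\times s$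 minor is a nonzero polynomial; the matrix is generically of full rank if its generic rank is the smaller of its numbers of rows and columns (here, $m=kn-\ell$). Then the natural matrix of $G$ is generically of full rank, that is: 1. If $\mathbf U$ is the generic $kn\times\ell$ matrix, whose entries are $kn\ell$ independent variables $u_{c,s}$, over the field $F=\mathbb K(u_{c,s})$ of rational functions, then $\mathbf M_{k,\ell,d}(G;\mathbf U)$ is generically of full rank, for every choice of the basis. 2. There is a nonzero polynomial $P\in\mathbb K[u_{c,s}]$ such that for every matrix $\mathbf U\in\mathbb K^{kn\times\ell}$ with $P(\mathbf U)\ne 0$ the matrix $\mathbf M_{k,\ell,d}(G;\mathbf U)$ is generically of full rank, for every choice of the basis. -/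

import Mathlib

/-- A finite hypergraph on the vertex type `V` whose hyperedges form a multiset: the hyperedges are
indexed by `E`, and different indices may have the same set of endpoints. -/
structure MultiHypergraph (V E : Type*) where
  /-- the set of endpoints of a hyperedge -/
  ends : E → Finset V

namespace MultiHypergraph

variable {V E : Type*}

/-- Every hyperedge has exactly `d` distinct endpoints. -/
def IsUniform (G : MultiHypergraph V E) (d : ℕ) : Prop :=
  ∀ e, (G.ends e).card = d

/-- The hyperedges of the sub-hypergraph induced by the vertex set `V'`. -/
def inducedEdges [DecidableEq V] [Fintype E] (G : MultiHypergraph V E) (V' : Finset V) :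
    Finset E :=
  Finset.univ.filter fun e => G.ends e ⊆ V'

/-- `(k, ℓ)`-sparsity: a vertex set of size `n'` that induces `m' ≥ 1` hyperedges satisfies
`m' ≤ k n' - ℓ`. (Vertex sets inducing no hyperedge carry no condition; otherwise the empty
vertex set would violate the inequality as soon as `ℓ > 0`.) -/
def IsSparse [DecidableEq V] [Fintype E] (G : MultiHypergraph V E) (k ℓ : ℕ) : Prop :=
  ∀ V' : Finset V, (G.inducedEdges V').Nonempty → (G.inducedEdges V').card + ℓ ≤ k * V'.card

/-- The positions `(e, v, j)` at which the row of `e` may be nonzero: `v` is an endpoint of `e`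
and `j` is one of the `k` columns that belong to `v`. -/
abbrev Position (G : MultiHypergraph V E) (k : ℕ) : Type _ :=
  {p : E × V // p.2 ∈ G.ends p.1} × Fin k

/-- The matrix with one row for each hyperedge and `k` columns for each vertex that has the entries
`a` at the positions of `G` and zeros elsewhere. -/
def patternMatrix [DecidableEq V] (G : MultiHypergraph V E) (k : ℕ) {R : Type*} [Zero R]
    (a : G.Position k → R) : Matrix E (V × Fin k) R :=
  fun e c => if h : c.1 ∈ G.ends e then a (⟨(e, c.1), h⟩, c.2) else 0

/-- For a fixed matrix `U`, the space of the fillings `a` of the positions of `G` that solve the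
homogeneous linear system `M(a) U = 0`, where `M(a)` is the matrix filled in by `a`. -/
def solutionSpace [DecidableEq V] [Fintype V] (G : MultiHypergraph V E) (k ℓ : ℕ)
    {K : Type*} [Field K] (U : Matrix (V × Fin k) (Fin ℓ) K) :
    Submodule K (G.Position k → K) where
  carrier := {a | G.patternMatrix k a * U = 0}
  zero_mem' := by
    have h : G.patternMatrix k (0 : G.Position k → K) = 0 := by
      ext e c
      simp [patternMatrix]
    simp [h]
  add_mem' := by
    intro a b ha hb
    have h : G.patternMatrix k (a + b) = G.patternMatrix k a + G.patternMatrix k b := by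
      ext e c
      by_cases hc : c.1 ∈ G.ends e <;> simp [patternMatrix, hc]
    simp only [Set.mem_ofPred_eq] at ha hb ⊢
    rw [h, Matrix.add_mul, ha, hb, add_zero]
  smul_mem' := by
    intro r a ha
    have h : G.patternMatrix k (r • a) = r • G.patternMatrix k a := by
      ext e c
      by_cases hc : c.1 ∈ G.ends e <;> simp [patternMatrix, hc]
    simp only [Set.mem_ofPred_eq] at ha ⊢
    rw [h, Matrix.smul_mul, ha, smul_zero]

/-- The formal general solution of `M(a) U = 0`, as a generic matrix: given a basis `b` of the
solution space, it is the matrix filled in by `∑ i, t i • b i` with generic variables `t i`. -/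
noncomputable def naturalMatrix [DecidableEq V] [Fintype V] (G : MultiHypergraph V E) (k ℓ : ℕ)
    {K : Type*} [Field K] (U : Matrix (V × Fin k) (Fin ℓ) K) {ι : Type*} [Fintype ι]
    (b : Module.Basis ι K (G.solutionSpace k ℓ U)) :
    Matrix E (V × Fin k) (MvPolynomial ι K) :=
  G.patternMatrix k fun p => ∑ i, MvPolynomial.C ((b i : G.Position k → K) p) * MvPolynomial.X i

end MultiHypergraph

/-- The field of rational functions over `𝕜` in the generic variables `u_{c,s}`, where `c` runs
through the `k` columns of each vertex and `s` through `1, …, ℓ`. -/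
abbrev GenericField (𝕜 : Type*) [Field 𝕜] (V : Type*) (k ℓ : ℕ) : Type _ :=
  FractionRing (MvPolynomial ((V × Fin k) × Fin ℓ) 𝕜)

/-- The `kn × ℓ` matrix with generic entries. -/
noncomputable def genericU (𝕜 : Type*) [Field 𝕜] (V : Type*) (k ℓ : ℕ) :
    Matrix (V × Fin k) (Fin ℓ) (GenericField 𝕜 V k ℓ) :=
  fun c s => algebraMap (MvPolynomial ((V × Fin k) × Fin ℓ) 𝕜) _ (MvPolynomial.X (c, s))

/-- The generic rank of a matrix of polynomials: the largest `r` for which some `r × r` minor is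
formally nonzero. -/
noncomputable def genericRank {m n σ K : Type*} [Field K]
    (M : Matrix m n (MvPolynomial σ K)) : ℕ :=
  sSup {r : ℕ | ∃ (f : Fin r ↪ m) (g : Fin r ↪ n), (M.submatrix f g).det ≠ 0}

/-- The generic rank is as large as the size of the matrix permits. -/
def IsGenericallyFullRank {m n σ K : Type*} [Fintype m] [Fintype n] [Field K]
    (M : Matrix m n (MvPolynomial σ K)) : Prop :=
  genericRank M = min (Fintype.card m) (Fintype.card n)

/-! By specialization, it suffices to find one solution matrix, polynomial in the entries of `U`,
with a maximal minor that is a nonzero polynomial; this minor serves as `P`, and nonvanishing can be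
tested at a single point `U₀`. To get `U₀`, start from a matrix `M₀` instead: fill the positions of
`G` so that `M₀` has a nonzero maximal minor and no nonzero kernel vector vanishes on all columns of
some hyperedge. Sparsity provides, through Hall's theorem, the matchings that make the required
minors nonzero for generic entries (`exists_filling`). Let the columns of `U₀` be a basis of the
kernel, of dimension `ℓ`. For each `e`, the rows of `U₀` at `e` then have rank `ℓ`, so `U₀` has a
left inverse supported on `e`. It allows each row of `M₀` to be corrected, polynomially in `U` and
within its support, to a row orthogonal to `U`; at `U₀` the correction is trivial and returns `M₀`
(`exists_polynomial_solution`). -/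

/-! ### Matchings from sparsity -/

open Finset in
/-- Hall's condition for hyperedges against the columns of their endpoints. -/
theorem MultiHypergraph.IsSparse.exists_injective_column {V E : Type*} [DecidableEq V] [Fintype E]
    {G : MultiHypergraph V E} {k ℓ : ℕ} (hG : G.IsSparse k ℓ) :
    ∃ g : E → V × Fin k, Function.Injective g ∧ ∀ e, (g e).1 ∈ G.ends e := by
  classical
  obtain ⟨g, hg, hmem⟩ := (Finset.all_card_le_biUnion_card_iff_exists_injective
    (fun e => G.ends e ×ˢ (univ : Finset (Fin k)))).1 fun s => by
      have hunion : s.biUnion (fun e => G.ends e ×ˢ (univ : Finset (Fin k))) =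
          s.biUnion G.ends ×ˢ univ := by
        ext c; simp
      have hsub : s ⊆ G.inducedEdges (s.biUnion G.ends) := fun e he => by
        simpa [inducedEdges] using subset_biUnion_of_mem G.ends he
      rw [hunion, card_product, card_univ, Fintype.card_fin, mul_comm]
      rcases s.eq_empty_or_nonempty with rfl | hs
      · simp
      · have := hG _ (hs.mono hsub)
        have := card_le_card hsub
        omega
  exact ⟨g, hg, fun e => by simpa using hmem e⟩

open Finset in
/-- Hall's condition for the columns outside a given hyperedge against the hyperedges. -/
theorem MultiHypergraph.IsSparse.exists_injective_edge {V E : Type*} [Fintype V] [DecidableEq V]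
    [Fintype E] {G : MultiHypergraph V E} {k ℓ : ℕ} (hG : G.IsSparse k ℓ)
    (hm : Fintype.card E + ℓ = k * Fintype.card V) (e : E) :
    ∃ h : {c : V × Fin k // c.1 ∉ G.ends e} → E,
      Function.Injective h ∧ ∀ c, c.1.1 ∈ G.ends (h c) := by
  classical
  obtain ⟨h, hh, hmem⟩ := (Finset.all_card_le_biUnion_card_iff_exists_injective
    (fun c : {c : V × Fin k // c.1 ∉ G.ends e} => univ.filter fun e' => c.1.1 ∈ G.ends e')).1
    fun s => by
      set V' : Finset V := s.image fun c => c.1.1 with hV'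
      have hunion : s.biUnion (fun c => univ.filter fun e' => c.1.1 ∈ G.ends e') =
          (G.inducedEdges V'ᶜ)ᶜ := by
        ext e'
        simp only [mem_biUnion, mem_filter, mem_univ, true_and, mem_compl, inducedEdges,
          subset_iff, hV', mem_image, not_forall, not_not, exists_prop]
        constructor
        · rintro ⟨c, hc, hce⟩
          exact ⟨_, hce, c, hc, rfl⟩
        · rintro ⟨_, hce, c, hc, rfl⟩
          exact ⟨c, hc, hce⟩
      -- All columns of `s` avoid `e`, so `V'ᶜ` induces `e` and its sparsity bound is available.
      -- Subtracted from `m = kn - ℓ`, it leaves at least `k * #V'` hyperedges that meet `V'`.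
      have he : e ∈ G.inducedEdges V'ᶜ := by
        simp only [inducedEdges, mem_filter, mem_univ, true_and, subset_iff, mem_compl, hV',
          mem_image, not_exists, not_and]
        rintro v hv c - rfl
        exact c.2 hv
      have hs : #s ≤ #(V' ×ˢ (univ : Finset (Fin k))) :=
        card_le_card_of_injOn (fun c => c.1)
          (fun c hc => by
            simpa [hV'] using ⟨c.1.2, c.2, hc⟩)
          Subtype.val_injective.injOn
      rw [card_product, card_univ, Fintype.card_fin, mul_comm] at hs
      have hsparse := hG _ ⟨e, he⟩
      have h₁ := card_compl_add_card (G.inducedEdges V'ᶜ)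
      have h₂ := congrArg (k * ·) (card_compl_add_card V')
      simp only [mul_add] at h₂
      rw [hunion]
      omega
  exact ⟨h, hh, fun c => by simpa using hmem c⟩

/-! ### Generic fillings of the pattern -/

theorem MultiHypergraph.patternMatrix_map {V E : Type*} [DecidableEq V] (G : MultiHypergraph V E)
    (k : ℕ) {R S : Type*} [Semiring R] [Semiring S] (φ : R →+* S) (a : G.Position k → R) :
    (G.patternMatrix k a).map φ = G.patternMatrix k fun p => φ (a p) := by
  ext e c
  by_cases hc : c.1 ∈ G.ends e <;> simp [patternMatrix, hc]

/-- A matrix supported on the positions of `G` is a pattern matrix. -/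
theorem MultiHypergraph.patternMatrix_of_support {V E : Type*} [DecidableEq V]
    (G : MultiHypergraph V E) (k : ℕ) {R : Type*} [Zero R] (M : Matrix E (V × Fin k) R)
    (hM : ∀ e c, c.1 ∉ G.ends e → M e c = 0) :
    G.patternMatrix k (fun p => M p.1.1.1 (p.1.1.2, p.2)) = M := by
  ext e c
  by_cases hc : c.1 ∈ G.ends e <;> simp [patternMatrix, hc, hM]

/-- A minor of the pattern matrix with independent entries along a matching is nonzero. -/
theorem MultiHypergraph.det_submatrix_patternMatrix_X_ne_zero {V E : Type*} [DecidableEq V]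
    (G : MultiHypergraph V E) (k : ℕ) (K : Type*) [Field K] {ι : Type*} [Fintype ι]
    [DecidableEq ι] {f : ι → E} {g : ι → V × Fin k} (hf : Function.Injective f)
    (hg : Function.Injective g) (h : ∀ i, (g i).1 ∈ G.ends (f i)) :
    ((G.patternMatrix k (MvPolynomial.X (R := K))).submatrix f g).det ≠ 0 := by
  classical
  intro h0
  -- The indicator of the matching turns the submatrix into the identity.
  let x : G.Position k → K := fun p => if ∃ i, f i = p.1.1.1 ∧ g i = (p.1.1.2, p.2) then 1 else 0
  have h1 := congrArg (MvPolynomial.eval x) h0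
  have h2 : (((G.patternMatrix k (MvPolynomial.X (R := K))).submatrix f g).map
      (MvPolynomial.eval x)) = 1 := by
    rw [← Matrix.submatrix_map, patternMatrix_map]
    ext i j
    by_cases hij : i = j
    · subst hij
      have : ∃ i', f i' = f i ∧ g i' = g i := ⟨i, rfl, rfl⟩
      simp [patternMatrix, h, x, this]
    · have : ¬ ∃ i', f i' = f i ∧ g i' = g j := by
        rintro ⟨i', h₁, h₂⟩
        exact hij ((hf h₁).symm.trans (hg h₂))
      simp [patternMatrix, x, this, hij]
  rw [RingHom.map_det, RingHom.mapMatrix_apply, h2] at h1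
  simp at h1

/-- Over an infinite field, the positions of `G` can be filled such that the matrix has a nonzero
maximal minor and stays injective on the vectors vanishing on any one hyperedge. -/
theorem MultiHypergraph.IsSparse.exists_filling {V E : Type*} [Fintype V] [DecidableEq V]
    [Fintype E] [DecidableEq E] {G : MultiHypergraph V E} {k ℓ : ℕ} (hG : G.IsSparse k ℓ)
    (hm : Fintype.card E + ℓ = k * Fintype.card V) (K : Type*) [Field K] [Infinite K] :
    ∃ (a : G.Position k → K) (g : E → V × Fin k), Function.Injective g ∧
      ((G.patternMatrix k a).submatrix id g).det ≠ 0 ∧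
      ∀ e (x : V × Fin k → K), (G.patternMatrix k a).mulVec x = 0 →
        (∀ c, c.1 ∈ G.ends e → x c = 0) → x = 0 := by
  classical
  obtain ⟨g, hg, hgmem⟩ := hG.exists_injective_column
  choose h hh hhmem using hG.exists_injective_edge hm
  let A := G.patternMatrix k (MvPolynomial.X (R := K))
  -- The product lets a single point of the infinite field avoid the zeros of all these minors at
  -- once.
  have hQ : (A.submatrix id g).det * ∏ e, (A.submatrix (h e) Subtype.val).det ≠ 0 :=
    mul_ne_zero
      (G.det_submatrix_patternMatrix_X_ne_zero k K Function.injective_id hg hgmem)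
      (Finset.prod_ne_zero_iff.2 fun e _ =>
        G.det_submatrix_patternMatrix_X_ne_zero k K (hh e) Subtype.val_injective (hhmem e))
  obtain ⟨a, ha⟩ : ∃ a, MvPolynomial.eval a
      ((A.submatrix id g).det * ∏ e, (A.submatrix (h e) Subtype.val).det) ≠ 0 := by
    by_contra! H
    exact hQ (MvPolynomial.funext fun a => by rw [H a, map_zero])
  have hA : A.map (MvPolynomial.eval a) = G.patternMatrix k a := by
    rw [patternMatrix_map]
    simp
  simp only [map_mul, map_prod, RingHom.map_det, RingHom.mapMatrix_apply,
    ← Matrix.submatrix_map, hA] at ha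
  refine ⟨a, g, hg, left_ne_zero_of_mul ha, fun e x hx hxe => ?_⟩
  have hdet := Finset.prod_ne_zero_iff.1 (right_ne_zero_of_mul ha) e (Finset.mem_univ e)
  have hy : (fun c : {c : V × Fin k // c.1 ∉ G.ends e} => x c) = 0 := by
    refine Matrix.eq_zero_of_mulVec_eq_zero hdet ?_
    ext c
    have hc := congrFun hx (h e c)
    rw [Matrix.mulVec, dotProduct, ← Fintype.sum_subtype_add_sum_subtype
      (fun c : V × Fin k => c.1 ∉ G.ends e)] at hc
    rw [Fintype.sum_eq_zero (fun c : {c : V × Fin k // ¬ c.1 ∉ G.ends e} => _)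
      (fun c => by rw [hxe _ (not_not.1 c.2), mul_zero]), add_zero] at hc
    exact hc
  ext c
  by_cases hc : c.1 ∈ G.ends e
  · exact hxe c hc
  · exact congrFun hy ⟨c, hc⟩

/-! ### Kernel bases and supported left inverses -/

/-- A matrix with linearly independent rows is annihilated by some matrix whose columns form a
basis of its kernel. -/
theorem Matrix.exists_mul_eq_zero_of_card_add_eq {K m n : Type*} [Field K] [Fintype m] [Fintype n]
    [DecidableEq m] [DecidableEq n] {ℓ : ℕ} (M : Matrix m n K)
    (hcard : Fintype.card m + ℓ = Fintype.card n) {g : m → n}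
    (hM : (M.submatrix id g).det ≠ 0) :
    ∃ U : Matrix n (Fin ℓ) K, M * U = 0 ∧ Function.Injective U.mulVec := by
  have hrank : M.rank = Fintype.card m := by
    refine LinearIndependent.rank_matrix ?_
    rw [← Matrix.vecMul_injective_iff]
    have hinj : Function.Injective (M.submatrix id g).vecMul :=
      Matrix.vecMul_injective_of_isUnit
        ((Matrix.isUnit_iff_isUnit_det _).2 (isUnit_iff_ne_zero.2 hM))
    intro x y hxy
    refine hinj ?_
    ext i
    exact congrFun hxy (g i)
  have hker : Module.finrank K (LinearMap.ker M.mulVecLin) = ℓ := by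
    have := M.mulVecLin.finrank_range_add_finrank_ker
    rw [Module.finrank_fintype_fun_eq_card] at this
    have h2 : Module.finrank K (LinearMap.range M.mulVecLin) = Fintype.card m := hrank
    omega
  let b := Module.finBasisOfFinrankEq K _ hker
  refine ⟨Matrix.of fun c s => (b s : n → K) c, ?_, ?_⟩
  · ext i s
    exact congrFun (LinearMap.mem_ker.1 (b s).2) i
  · rw [Matrix.mulVec_injective_iff]
    exact b.linearIndependent.map' (LinearMap.ker M.mulVecLin).subtype (Submodule.ker_subtype _)

/-- If `U` is injective after deleting the rows outside `s`, it has a left inverse supported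
on `s`. -/
theorem Matrix.exists_mul_eq_one_of_support {K n l : Type*} [Field K] [Fintype n] [Fintype l]
    [DecidableEq n] [DecidableEq l] (U : Matrix n l K) (s : Set n)
    (hU : ∀ y, (∀ c ∈ s, U.mulVec y c = 0) → y = 0) :
    ∃ L : Matrix l n K, L * U = 1 ∧ ∀ i, ∀ c ∉ s, L i c = 0 := by
  classical
  -- `D` erases the coordinates outside `s`. If `φ` is a left inverse of `D * U`, then `φ * D` is a
  -- left inverse of `U` supported on `s`.
  let D : Matrix n n K := Matrix.diagonal fun c => if c ∈ s then 1 else 0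
  have hinj : LinearMap.ker (Matrix.toLin' (D * U)) = ⊥ := by
    rw [LinearMap.ker_eq_bot']
    intro y hy
    refine hU y fun c hc => ?_
    have := congrFun hy c
    rw [Matrix.toLin'_apply, ← Matrix.mulVec_mulVec, Matrix.mulVec_diagonal] at this
    simpa [hc] using this
  obtain ⟨φ, hφ⟩ := LinearMap.exists_leftInverse_of_injective _ hinj
  refine ⟨LinearMap.toMatrix' φ * D, ?_, fun i c hc => ?_⟩
  · have := congrArg LinearMap.toMatrix' hφ
    rw [LinearMap.toMatrix'_comp, LinearMap.toMatrix'_toLin', LinearMap.toMatrix'_id] at this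
    rw [Matrix.mul_assoc, this]
  · simp [D, Matrix.mul_diagonal, hc]

/-! ### Correcting rows polynomially in `U` -/

/-- The row `x` corrected, by means of `L`, to a row orthogonal to the columns of `U`. -/
def Matrix.correctedRow {R n l : Type*} [CommRing R] [Fintype n] [Fintype l] [DecidableEq l]
    (L : Matrix l n R) (x : n → R) (U : Matrix n l R) : n → R :=
  (L * U).det • x - Matrix.vecMul (Matrix.vecMul (Matrix.vecMul x U) (L * U).adjugate) L

/-- Since `adj(LU) * LU = det(LU) * 1`, both terms become `det(LU) • xU`. The adjugate replaces the
inverse to avoid denominators. -/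
theorem Matrix.vecMul_correctedRow {R n l : Type*} [CommRing R] [Fintype n] [Fintype l]
    [DecidableEq l] (L : Matrix l n R) (x : n → R) (U : Matrix n l R) :
    Matrix.vecMul (L.correctedRow x U) U = 0 := by
  rw [correctedRow, Matrix.sub_vecMul, Matrix.smul_vecMul, Matrix.vecMul_vecMul,
    Matrix.vecMul_vecMul, Matrix.adjugate_mul]
  simp [Matrix.vecMul_smul]

theorem Matrix.correctedRow_eq_self {R n l : Type*} [CommRing R] [Fintype n] [Fintype l]
    [DecidableEq l] (L : Matrix l n R) (x : n → R) (U : Matrix n l R) (hL : L * U = 1)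
    (hx : Matrix.vecMul x U = 0) : L.correctedRow x U = x := by
  simp [correctedRow, hL, hx]

theorem Matrix.correctedRow_eq_zero {R n l : Type*} [CommRing R] [Fintype n] [Fintype l]
    [DecidableEq l] (L : Matrix l n R) (x : n → R) (U : Matrix n l R) (c : n)
    (hL : ∀ i, L i c = 0) (hx : x c = 0) : L.correctedRow x U c = 0 := by
  have hvec : ∀ v : l → R, Matrix.vecMul v L c = 0 := fun v => by
    simp [Matrix.vecMul, dotProduct, hL]
  rw [correctedRow, Pi.sub_apply, Pi.smul_apply, hx, smul_zero, hvec, sub_zero]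

theorem RingHom.comp_vecMul {R S m n : Type*} [CommRing R] [CommRing S] [Fintype m]
    (φ : R →+* S) (M : Matrix m n R) (v : m → R) :
    φ ∘ Matrix.vecMul v M = Matrix.vecMul (φ ∘ v) (M.map φ) :=
  funext fun i => RingHom.map_vecMul φ M v i

theorem Matrix.map_correctedRow {R S n l : Type*} [CommRing R] [CommRing S] [Fintype n]
    [Fintype l] [DecidableEq l] (φ : R →+* S) (L : Matrix l n R) (x : n → R) (U : Matrix n l R)
    (c : n) :
    φ (L.correctedRow x U c) = (L.map φ).correctedRow (φ ∘ x) (U.map φ) c := by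
  have hadj : ((L * U).adjugate).map φ = (L.map φ * U.map φ).adjugate := by
    rw [← Matrix.map_mul]
    exact RingHom.map_adjugate φ _
  have hdet : φ (L * U).det = (L.map φ * U.map φ).det := by
    rw [← Matrix.map_mul]
    exact RingHom.map_det φ _
  simp only [correctedRow, Pi.sub_apply, Pi.smul_apply, smul_eq_mul, map_sub, map_mul, hdet,
    Function.comp_apply]
  rw [RingHom.map_vecMul, φ.comp_vecMul, φ.comp_vecMul, hadj]

/-- A polynomial family of matrices on the positions of `G` that annihilate the generic matrix `U`
and have a maximal minor that is not the zero polynomial. -/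
theorem MultiHypergraph.IsSparse.exists_polynomial_solution {V E : Type*} [Fintype V]
    [DecidableEq V] [Fintype E] [DecidableEq E] {G : MultiHypergraph V E} {k ℓ : ℕ}
    (hG : G.IsSparse k ℓ) (hm : Fintype.card E + ℓ = k * Fintype.card V)
    (K : Type*) [Field K] [Infinite K] :
    ∃ (a : G.Position k → MvPolynomial ((V × Fin k) × Fin ℓ) K) (g : E → V × Fin k),
      Function.Injective g ∧
      G.patternMatrix k a *
        Matrix.of (fun (c : V × Fin k) (s : Fin ℓ) => MvPolynomial.X (R := K) (c, s)) = 0 ∧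
      ((G.patternMatrix k a).submatrix id g).det ≠ 0 := by
  obtain ⟨a₀, g, hg, hdet, hinj⟩ := hG.exists_filling hm K
  set M₀ := G.patternMatrix k a₀ with hM₀
  obtain ⟨U₀, hMU, hU₀⟩ := M₀.exists_mul_eq_zero_of_card_add_eq (ℓ := ℓ)
    (by rw [hm, Fintype.card_prod, Fintype.card_fin, mul_comm]) hdet
  have hleft : ∀ e, ∃ L : Matrix (Fin ℓ) (V × Fin k) K, L * U₀ = 1 ∧
      ∀ i, ∀ c ∉ {c : V × Fin k | c.1 ∈ G.ends e}, L i c = 0 := fun e =>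
    -- `U₀ y` lies in the kernel of `M₀` and vanishes on `e`, hence is zero; then `y = 0`, as `U₀`
    -- is injective.
    U₀.exists_mul_eq_one_of_support _ fun y hy => hU₀ <| by
      rw [Matrix.mulVec_zero]
      exact hinj e _ (by rw [Matrix.mulVec_mulVec, hMU, Matrix.zero_mulVec]) hy
  choose L hL hLsupp using hleft
  let X : Matrix (V × Fin k) (Fin ℓ) (MvPolynomial ((V × Fin k) × Fin ℓ) K) :=
    Matrix.of fun c s => MvPolynomial.X (c, s)
  let N : Matrix E (V × Fin k) (MvPolynomial ((V × Fin k) × Fin ℓ) K) := Matrix.of fun e =>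
    ((L e).map MvPolynomial.C).correctedRow (MvPolynomial.C ∘ M₀ e) X
  have hN : G.patternMatrix k (fun p => N p.1.1.1 (p.1.1.2, p.2)) = N :=
    G.patternMatrix_of_support k N fun e c hc =>
      Matrix.correctedRow_eq_zero _ _ _ _
        (fun i => by rw [Matrix.map_apply, hLsupp e i c hc, map_zero])
        (by simp [hM₀, patternMatrix, hc])
  refine ⟨fun p => N p.1.1.1 (p.1.1.2, p.2), g, hg, ?_, fun h0 => hdet ?_⟩
  · rw [hN]
    ext1 e
    exact congrFun
      (Matrix.vecMul_correctedRow ((L e).map MvPolynomial.C) (MvPolynomial.C ∘ M₀ e) X)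
  · rw [hN] at h0
    -- At `U₀` the equations `L e * U₀ = 1` and `M₀ * U₀ = 0` make the correction trivial.
    have hmap : N.map (MvPolynomial.eval fun q : (V × Fin k) × Fin ℓ => U₀ q.1 q.2) = M₀ := by
      ext e c
      rw [Matrix.map_apply]
      refine (Matrix.map_correctedRow _ ((L e).map MvPolynomial.C) (MvPolynomial.C ∘ M₀ e) X
        c).trans ?_
      have h₁ : ((L e).map MvPolynomial.C).map
          (MvPolynomial.eval fun q : (V × Fin k) × Fin ℓ => U₀ q.1 q.2) = L e := by
        ext; simp
      have h₂ : X.map (MvPolynomial.eval fun q : (V × Fin k) × Fin ℓ => U₀ q.1 q.2) = U₀ := by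
        ext; simp [X]
      have h₃ : (MvPolynomial.eval fun q : (V × Fin k) × Fin ℓ => U₀ q.1 q.2) ∘
          MvPolynomial.C ∘ M₀ e = M₀ e := by
        ext; simp
      rw [h₁, h₂, h₃, Matrix.correctedRow_eq_self _ _ _ (hL e) (congrFun hMU e)]
    have := congrArg (MvPolynomial.eval fun q : (V × Fin k) × Fin ℓ => U₀ q.1 q.2) h0
    rwa [RingHom.map_det, RingHom.mapMatrix_apply, ← Matrix.submatrix_map, hmap, map_zero] at this

/-! ### Full generic rank from one solution -/

/-- A nonzero minor that uses all rows witnesses full generic rank. -/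
theorem isGenericallyFullRank_of_det_ne_zero {m n σ K : Type*} [Fintype m] [Fintype n]
    [DecidableEq m] [Field K] (M : Matrix m n (MvPolynomial σ K)) {g : m → n}
    (hg : Function.Injective g) (hM : (M.submatrix id g).det ≠ 0) :
    IsGenericallyFullRank M := by
  rw [IsGenericallyFullRank, min_eq_left (Fintype.card_le_of_injective g hg)]
  refine IsGreatest.csSup_eq ⟨?_, ?_⟩
  · let ε := (Fintype.equivFin m).symm
    refine ⟨ε.toEmbedding, ε.toEmbedding.trans ⟨g, hg⟩, ?_⟩
    rwa [← Matrix.det_submatrix_equiv_self ε] at hM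
  · rintro r ⟨f, -, -⟩
    simpa using Fintype.card_le_of_embedding f

/-- The natural matrix has full generic rank as soon as one solution has a nonzero maximal
minor. -/
theorem MultiHypergraph.isGenericallyFullRank_naturalMatrix {V E : Type*} [Fintype V]
    [DecidableEq V] [Fintype E] [DecidableEq E] (G : MultiHypergraph V E) {k ℓ : ℕ} {K : Type*}
    [Field K] {U : Matrix (V × Fin k) (Fin ℓ) K} {ι : Type*} [Fintype ι]
    (b : Module.Basis ι K (G.solutionSpace k ℓ U)) {a : G.Position k → K}
    (ha : G.patternMatrix k a * U = 0) {g : E → V × Fin k} (hg : Function.Injective g)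
    (hdet : ((G.patternMatrix k a).submatrix id g).det ≠ 0) :
    IsGenericallyFullRank (G.naturalMatrix k ℓ U b) := by
  refine isGenericallyFullRank_of_det_ne_zero _ hg fun h0 => hdet ?_
  let a' : G.solutionSpace k ℓ U := ⟨a, ha⟩
  -- Setting each `t i` to the `i`-th coordinate of the solution `a` recovers its matrix.
  have heval : (G.naturalMatrix k ℓ U b).map (MvPolynomial.eval fun i => b.repr a' i) =
      G.patternMatrix k a := by
    rw [naturalMatrix, patternMatrix_map]
    congr 1
    ext p
    have := congrFun (congrArg Subtype.val (b.sum_repr a')) p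
    simp only [Submodule.coe_sum, Submodule.coe_smul, Finset.sum_apply, Pi.smul_apply,
      smul_eq_mul] at this
    simpa [mul_comm] using this
  have := congrArg (MvPolynomial.eval fun i => b.repr a' i) h0
  rwa [RingHom.map_det, RingHom.mapMatrix_apply, ← Matrix.submatrix_map, heval, map_zero] at this

/-- Solutions with a nonzero maximal minor are preserved by ring homomorphisms under which the minor
stays nonzero. -/
theorem MultiHypergraph.map_solution {V E R S l : Type*} [Fintype V] [DecidableEq V] [Fintype E]
    [DecidableEq E] [CommRing R] [CommRing S] (G : MultiHypergraph V E) {k : ℕ} (φ : R →+* S)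
    {a : G.Position k → R} {U : Matrix (V × Fin k) l R} {g : E → V × Fin k}
    (ha : G.patternMatrix k a * U = 0)
    (hφ : φ ((G.patternMatrix k a).submatrix id g).det ≠ 0) :
    G.patternMatrix k (fun p => φ (a p)) * U.map φ = 0 ∧
      ((G.patternMatrix k fun p => φ (a p)).submatrix id g).det ≠ 0 := by
  rw [RingHom.map_det, RingHom.mapMatrix_apply, ← Matrix.submatrix_map,
    patternMatrix_map] at hφ
  refine ⟨?_, hφ⟩
  rw [← patternMatrix_map, ← Matrix.map_mul, ha, Matrix.map_zero _ (map_zero φ)]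

theorem mainTheorem2 {𝕜 : Type*} [RCLike 𝕜] {V E : Type*} [Fintype V] [DecidableEq V] [Fintype E]
    (k ℓ d : ℕ) (hkld : ℓ + 1 ≤ d * k)
    (G : MultiHypergraph V E) (hd : G.IsUniform d)
    (hm : Fintype.card E + ℓ = k * Fintype.card V) (hG : G.IsSparse k ℓ) :
    (∀ {ι : Type*} [Fintype ι]
      (b : Module.Basis ι (GenericField 𝕜 V k ℓ) (G.solutionSpace k ℓ (genericU 𝕜 V k ℓ))),
      IsGenericallyFullRank (G.naturalMatrix k ℓ (genericU 𝕜 V k ℓ) b)) ∧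
    ∃ P : MvPolynomial ((V × Fin k) × Fin ℓ) 𝕜, P ≠ 0 ∧
      ∀ U : Matrix (V × Fin k) (Fin ℓ) 𝕜, MvPolynomial.eval (fun q => U q.1 q.2) P ≠ 0 →
        ∀ {ι : Type*} [Fintype ι] (b : Module.Basis ι 𝕜 (G.solutionSpace k ℓ U)),
          IsGenericallyFullRank (G.naturalMatrix k ℓ U b) := by
  classical
  obtain ⟨a, g, hg, ha, hdet⟩ := hG.exists_polynomial_solution hm 𝕜
  -- The minor itself is `P`. It stays nonzero in the fraction field because the polynomial ring
  -- embeds there.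
  refine ⟨fun {ι} _ b => ?_, _, hdet, fun U hU {ι} _ b => ?_⟩
  · obtain ⟨h₁, h₂⟩ := G.map_solution (algebraMap _ (GenericField 𝕜 V k ℓ)) ha fun h =>
      hdet ((map_eq_zero_iff _ (IsFractionRing.injective _ _)).1 h)
    exact G.isGenericallyFullRank_naturalMatrix b h₁ hg h₂
  · obtain ⟨h₁, h₂⟩ := G.map_solution _ ha hU
    refine G.isGenericallyFullRank_naturalMatrix b ?_ hg h₂
    convert h₁
    ext
    simp
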